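/- For $n\in\mathbb{N}$, let $S_n(132)$ be the set of permutations $\sigma=\sigma_1\cdots\sigma_n$ of $\{1,\dots,n\}$ that avoid the pattern $132$, that is, for which there are no indices $i_1<i_2<i_3$ with $\sigma_{i_1}<\sigma_{i_3}<\sigma_{i_2}$, and let $E_n^{\mathrm{av}(132)}$ denote expectation with respect to the uniform probability measure on $S_n(132)$. A subsequence $\sigma_{i_1},\dots,\sigma_{i_{4k+1}}$ of $\sigma$ (with $i_1<\dots<i_{4k+1}$ and $k\ge1$) \emph{repeats the pattern} $UUUD$ if, for every $j\in\{1,\dots,4k\}$, one has $\sigma_{i_{j+1}}<\sigma_{i_j}$ when $j$ is divisible by $4$ and $\sigma_{i_{j+1}}>\sigma_{i_j}$ otherwise. Let $L_n^{U^3D}(\sigma)$ be the length (number of entries) of a longest subsequence of $\sigma$ that repeats the pattern $UUUD$, with $L_n^{U^3D}(\sigma)=0$ if there is none; so for every $\sigma\in S_n(132)$, $L_n^{U^3D}(\sigma)$ is either $0$ or $4k+1$ for some integer $k\ge1$. Then $$E_n^{\mathrm{av}(132)}L_n^{U^3D}\sim\frac{4}{11}\,n\qquad\text{as } n\to\infty.$$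 -/

import Mathlib

open Filter Asymptotics

/-- The two kinds of vertical step: up and down. -/
inductive UpDown where
  | U : UpDown
  | D : UpDown

/-- `v.Holds a b`: the step from the value `a` to the value `b` goes in the direction `v`. -/
def UpDown.Holds {α : Type*} [LT α] : UpDown → α → α → Prop
  | UpDown.U, a, b => a < b
  | UpDown.D, a, b => b < a

/-- The subsequence of `σ` at the positions `i 0 < i 1 < ⋯ < i (k * l)` (it has length
`k * l + 1`) consists of exactly `k` complete repetitions of the up/down pattern
`V 0, …, V (l - 1)`: its `j`-th step, counted from `0`, has direction `V (j mod l)`. -/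
def RepeatsPattern {l n : ℕ} [NeZero l] (V : Fin l → UpDown) (σ : Equiv.Perm (Fin n)) (k : ℕ)
    (i : Fin (k * l + 1) → Fin n) : Prop :=
  StrictMono i ∧
    ∀ j : Fin (k * l), (V (Fin.ofNat l (j : ℕ))).Holds (σ (i j.castSucc)) (σ (i j.succ))

/-- The length of the longest subsequence of `σ` that repeats the up/down pattern `V`.
Incomplete repetitions are not counted and at least one complete repetition is required;
the value is `0` if the pattern does not occur.  (The set is bounded by `n`, since a strictly
increasing map of `Fin m` into `Fin n` forces `m ≤ n`.) -/
noncomputable def longestRepeat {l n : ℕ} [NeZero l] (V : Fin l → UpDown)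
    (σ : Equiv.Perm (Fin n)) : ℕ :=
  sSup {m : ℕ | ∃ k : ℕ, 1 ≤ k ∧ m = k * l + 1 ∧
    ∃ i : Fin (k * l + 1) → Fin n, RepeatsPattern V σ k i}

/-- The pattern `UUUD`. -/
def patternUUUD : Fin 4 → UpDown := ![UpDown.U, UpDown.U, UpDown.U, UpDown.D]

/-- `σ` contains `τ` as a pattern: some subsequence of `σ` is order isomorphic to `τ`. -/
def ContainsPattern {m n : ℕ} (τ : Equiv.Perm (Fin m)) (σ : Equiv.Perm (Fin n)) : Prop :=
  ∃ i : Fin m → Fin n, StrictMono i ∧ ∀ j k : Fin m, σ (i j) < σ (i k) ↔ τ j < τ k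

/-- The permutation `132`; with values shifted to start at `0`, it maps `0, 1, 2` to `0, 2, 1`. -/
def perm132 : Equiv.Perm (Fin 3) := Equiv.swap 1 2

open Classical in
/-- `S_n(τ)`: the permutations of an `n`-element linear order that avoid the pattern `τ`. -/
noncomputable def avoiders {m : ℕ} (τ : Equiv.Perm (Fin m)) (n : ℕ) :
    Finset (Equiv.Perm (Fin n)) :=
  Finset.univ.filter fun σ => ¬ ContainsPattern τ σ

/-- The expectation of `X` under the uniform probability measure on `S_n(τ)`. -/
noncomputable def avoidExpect {m : ℕ} (τ : Equiv.Perm (Fin m)) (n : ℕ)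
    (X : Equiv.Perm (Fin n) → ℝ) : ℝ :=
  (∑ σ ∈ avoiders τ n, X σ) / ((avoiders τ n).card : ℝ)

/-! In a 132-avoiding word `A m B` with largest letter `m`, every letter of `A` exceeds every letter
of `B`, so these words correspond to binary trees. Let `M` be the largest length of a subsequence
following `UUUD` periodically, with an incomplete last period allowed. A passage from `A m` to `B`
is a descent, hence possible only after a multiple of four letters; this gives the recursion
`treeMax` for `M`.

The recursion makes `M / 4` additive over the two subtrees, up to a toll 1 when `M ≡ 3` modulo 4 on
the left subtree (`treeMax_div_four_node`). Let `T`, `G`, `K`, `B` be the generating functions of `M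
/ 4`, of the toll, of the Catalan numbers and of the central binomial coefficients. Then `T = X (2 T
K + G K)` and `B = 1 / (1 - 2 X K)`, so `2 T = G B - G`. Asymptotically the `n`-th coefficient of
`T` is half of `G(1/4)` times the `n`-th central binomial coefficient, which is `n + 1` times the
Catalan number; the mean of `M / 4` is thus `G(1/4) n / 2` to first order.

The recursion modulo 4 gives a triangular system for `M = 0, 1, 2` and for the residues of `M`,
solved at `1/4` with `K(1/4) = 2`; it yields `G(1/4) = 2/11`. Since the length in question differs
from `4 (M / 4)` by at most 4, the constant is `4/11`. -/

/-! ### Longest `UUUD` subsequences of concatenated words -/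

/-- The list `s` starts following the up/down pattern `UUUD` repeated periodically. -/
def FollowsUUUD (s : List ℕ) : Prop :=
  ∀ (j : ℕ) (h : j + 1 < s.length),
    if 4 ∣ j + 1 then s[j + 1] < s[j] else s[j] < s[j + 1]

/-- `m` is the largest length of a sublist of `w` following the periodic pattern `UUUD`. -/
def IsMaxUUUD (w : List ℕ) (m : ℕ) : Prop :=
  (∃ s, s.Sublist w ∧ s.length = m ∧ FollowsUUUD s) ∧
    ∀ s, s.Sublist w → FollowsUUUD s → s.length ≤ m

theorem FollowsUUUD.take {s : List ℕ} (hs : FollowsUUUD s) (k : ℕ) :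
    FollowsUUUD (s.take k) := by
  intro j h
  have h' : j + 1 < s.length := by simp at h; omega
  simpa using hs j h'

theorem FollowsUUUD.left {s t : List ℕ} (h : FollowsUUUD (s ++ t)) : FollowsUUUD s := by
  simpa using h.take s.length

theorem FollowsUUUD.right {s t : List ℕ} (h : FollowsUUUD (s ++ t)) (hd : 4 ∣ s.length) :
    FollowsUUUD t := by
  intro j hj
  have h1 := h (s.length + j) (by simp; omega)
  have e : 4 ∣ s.length + j + 1 ↔ 4 ∣ j + 1 := by omega
  simp only [e] at h1
  simpa [List.getElem_append_right, Nat.add_assoc] using h1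

theorem FollowsUUUD.append {s t : List ℕ} (hs : FollowsUUUD s) (ht : FollowsUUUD t)
    (hd : 4 ∣ s.length) (hst : ∀ x ∈ s, ∀ y ∈ t, y < x) : FollowsUUUD (s ++ t) := by
  intro j hj
  rcases lt_trichotomy (j + 1) s.length with h | h | h
  · have := hs j h
    simpa [List.getElem_append_left, h, Nat.lt_of_succ_lt h] using this
  · rw [if_pos (by omega)]
    simp only [List.length_append] at hj
    have h1 : j < s.length := by omega
    rw [List.getElem_append_left h1, List.getElem_append_right h.ge]
    exact hst _ (List.getElem_mem _) _ (List.getElem_mem _)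
  · simp only [List.length_append] at hj
    obtain ⟨i, rfl⟩ : ∃ i, j = s.length + i := ⟨j - s.length, by omega⟩
    have e : 4 ∣ s.length + i + 1 ↔ 4 ∣ i + 1 := by omega
    have := ht i (by omega)
    simp only [e]
    simpa [List.getElem_append_right, Nat.add_assoc] using this

theorem FollowsUUUD.concat {s : List ℕ} {m : ℕ} (hs : FollowsUUUD s)
    (hd : s.length = 0 ∨ ¬ 4 ∣ s.length) (hm : ∀ x ∈ s, x < m) : FollowsUUUD (s ++ [m]) := by
  intro j hj
  simp only [List.length_append, List.length_singleton] at hj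
  rcases lt_or_eq_of_le (show j + 1 ≤ s.length by omega) with h | h
  · have := hs j h
    simpa [List.getElem_append_left, h, Nat.lt_of_succ_lt h] using this
  · rw [if_neg (by omega), List.getElem_append_left (by omega : j < s.length),
      List.getElem_append_right h.ge]
    simpa using hm _ (List.getElem_mem _)

theorem isMaxUUUD_nil : IsMaxUUUD [] 0 :=
  ⟨⟨[], .slnil, rfl, by intro j h; simp at h⟩, fun s hs _ => by simp [List.sublist_nil.1 hs]⟩

/-- A new largest letter can only be reached by an up step, and the next step is down exactly when
the current length is a positive multiple of 4. -/
theorem IsMaxUUUD.concat {A : List ℕ} {a m : ℕ} (h : IsMaxUUUD A a) (hm : ∀ x ∈ A, x < m) :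
    IsMaxUUUD (A ++ [m]) (if a = 0 then 1 else if 4 ∣ a then a else a + 1) := by
  obtain ⟨⟨s, hs, hl, hf⟩, hmax⟩ := h
  constructor
  · by_cases hd : a = 0 ∨ ¬ 4 ∣ a
    · refine ⟨s ++ [m], hs.append (List.Sublist.refl _), ?_,
        hf.concat (hl ▸ hd) fun x hx => hm x (hs.subset hx)⟩
      simp only [List.length_append, List.length_singleton]
      split_ifs <;> omega
    · push Not at hd
      exact ⟨s, hs.trans (List.sublist_append_left _ _), by simp [hd, hl], hf⟩
  · intro s hs hf
    obtain ⟨s₁, s₂, rfl, h₁, h₂⟩ := List.sublist_append_iff.1 hs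
    have hle := hmax s₁ h₁ hf.left
    rcases List.sublist_singleton.1 h₂ with rfl | rfl
    · simp only [List.append_nil]
      split_ifs <;> omega
    · by_cases hc : s₁.length = a ∧ a ≠ 0 ∧ 4 ∣ a
      · exfalso
        obtain ⟨he, h0, hd⟩ := hc
        have := hf (a - 1) (by simp; omega)
        rw [if_pos (by omega), List.getElem_append_left (by omega : a - 1 < s₁.length),
          List.getElem_append_right (by omega)] at this
        have h3 := hm _ (h₁.subset (List.getElem_mem (by omega : a - 1 < s₁.length)))
        simp at this
        omega
      · simp only [List.length_append, List.length_singleton]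
        split_ifs <;> omega

/-- The step from `A` to `B` is a descent, so a subsequence using both has a multiple of 4 letters
in `A`, and its part in `B` starts a fresh period. -/
theorem IsMaxUUUD.append {A B : List ℕ} {a b : ℕ} (hA : IsMaxUUUD A a) (hB : IsMaxUUUD B b)
    (h : ∀ x ∈ A, ∀ y ∈ B, y < x) : IsMaxUUUD (A ++ B) (max a (4 * (a / 4) + b)) := by
  obtain ⟨⟨s, hs, hl, hf⟩, hmax⟩ := hA
  obtain ⟨⟨t, ht, hl', hf'⟩, hmax'⟩ := hB
  constructor
  · rcases le_total (4 * (a / 4) + b) a with hab | hab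
    · exact ⟨s, hs.trans (List.sublist_append_left _ _), by omega, hf⟩
    · have hlen : (s.take (4 * (a / 4))).length = 4 * (a / 4) := by simp; omega
      refine ⟨s.take (4 * (a / 4)) ++ t, ((List.take_sublist _ _).trans hs).append ht, ?_,
        (hf.take _).append hf' ⟨_, hlen⟩ fun x hx y hy =>
          h x (hs.subset (List.mem_of_mem_take hx)) y (ht.subset hy)⟩
      rw [List.length_append, hlen]
      omega
  · intro u hu hfu
    obtain ⟨s₁, s₂, rfl, h₁, h₂⟩ := List.sublist_append_iff.1 hu
    have hle := hmax s₁ h₁ hfu.left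
    by_cases hs₂ : s₂.length = 0
    · simp only [List.length_append]; omega
    by_cases hs₁ : s₁.length = 0
    · have := hmax' s₂ h₂ (hfu.right (by simp [hs₁]))
      simp only [List.length_append]; omega
    have hd : 4 ∣ s₁.length := by
      by_contra hd
      have := hfu (s₁.length - 1) (by simp; omega)
      rw [if_neg (by omega), List.getElem_append_left (by omega),
          List.getElem_append_right (by omega)] at this
      have h3 := h _ (h₁.subset (List.getElem_mem (by omega : s₁.length - 1 < s₁.length))) _
        (h₂.subset (List.getElem_mem (by omega : s₁.length - 1 + 1 - s₁.length < s₂.length)))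
      omega
    have := hmax' s₂ h₂ (hfu.right hd)
    simp only [List.length_append]
    omega

/-! ### 132-avoiding words as binary trees -/

/-- Avoidance of `132` for lists of natural numbers. -/
def Avoids132 (w : List ℕ) : Prop :=
  ∀ x y z, [x, y, z].Sublist w → ¬ (x < z ∧ z < y)

/-- The word with letters `o, …, o + t.numNodes - 1` whose decomposition at the largest letter is
recorded by the binary tree `t`: the letters before it exceed those after it. -/
def treeWord : BinaryTree Unit → ℕ → List ℕ
  | .nil, _ => []
  | .node _ l r, o =>
      (treeWord l (o + r.numNodes) ++ [o + (l.numNodes + r.numNodes)]) ++ treeWord r o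

/-- The largest length of a sublist of `treeWord t o` following the periodic pattern `UUUD`. -/
def treeMax : BinaryTree Unit → ℕ
  | .nil => 0
  | .node _ l r =>
      let a := if treeMax l = 0 then 1 else if 4 ∣ treeMax l then treeMax l else treeMax l + 1
      max a (4 * (a / 4) + treeMax r)

theorem treeWord_perm (t : BinaryTree Unit) (o : ℕ) :
    (treeWord t o).Perm (List.range' o t.numNodes) := by
  induction t generalizing o with
  | nil => simp [treeWord]
  | node _ l r hl hr =>
    have e : List.range' o (l.numNodes + r.numNodes + 1) =
        List.range' o r.numNodes ++ (List.range' (o + r.numNodes) l.numNodes ++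
          [o + (l.numNodes + r.numNodes)]) := by
      rw [List.range'_concat, ← List.append_assoc, List.range'_append_1]
      simp [Nat.add_comm]
    rw [BinaryTree.numNodes, e]
    exact List.perm_append_comm.trans
      ((hr o).append ((hl _).append_right _))

theorem length_treeWord (t : BinaryTree Unit) (o : ℕ) :
    (treeWord t o).length = t.numNodes := by
  simpa using (treeWord_perm t o).length_eq

theorem mem_treeWord {t : BinaryTree Unit} {o x : ℕ} :
    x ∈ treeWord t o ↔ o ≤ x ∧ x < o + t.numNodes := by
  rw [(treeWord_perm t o).mem_iff, List.mem_range'_1]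

theorem isMaxUUUD_treeWord (t : BinaryTree Unit) (o : ℕ) :
    IsMaxUUUD (treeWord t o) (treeMax t) := by
  induction t generalizing o with
  | nil => exact isMaxUUUD_nil
  | node _ l r hl hr =>
    refine ((hl (o + r.numNodes)).concat ?_).append (hr o) ?_
    · intro x hx
      have := mem_treeWord.1 hx
      omega
    · intro x hx y hy
      have := mem_treeWord.1 hy
      rw [List.mem_append, mem_treeWord, List.mem_singleton] at hx
      omega

theorem avoids132_treeWord (t : BinaryTree Unit) (o : ℕ) : Avoids132 (treeWord t o) := by
  induction t generalizing o with
  | nil => intro x y z h; simp [treeWord] at h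
  | node _ l r hl hr =>
    intro x y z h
    rw [treeWord, List.append_assoc, List.sublist_append_iff] at h
    obtain ⟨s₁, s₂, he, h₁, h₂⟩ := h
    have hm : ∀ v ∈ s₂, v = o + (l.numNodes + r.numNodes) ∨ o ≤ v ∧ v < o + r.numNodes := by
      intro v hv
      simpa [mem_treeWord] using h₂.subset hv
    have hm' : ∀ v ∈ s₁, o + r.numNodes ≤ v ∧ v < o + r.numNodes + l.numNodes :=
      fun v hv => mem_treeWord.1 (h₁.subset hv)
    match s₁, he with
    | [], he =>
      simp only [List.nil_append] at he
      subst he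
      simp only [List.mem_cons, List.not_mem_nil, or_false, forall_eq_or_imp, forall_eq] at hm
      cases h₂ with
      | cons _ h => exact hr o x y z h
      | cons_cons _ h => omega
    | [_], he =>
      simp only [List.cons_append, List.nil_append, List.cons.injEq] at he
      obtain ⟨rfl, rfl⟩ := he
      simp only [List.mem_cons, List.not_mem_nil, or_false, forall_eq_or_imp, forall_eq] at hm hm'
      omega
    | [_, _], he =>
      simp only [List.cons_append, List.nil_append, List.cons.injEq] at he
      obtain ⟨rfl, rfl, rfl⟩ := he
      simp only [List.mem_cons, List.not_mem_nil, or_false, forall_eq_or_imp, forall_eq] at hm hm'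
      omega
    | [_, _, _], he =>
      simp only [List.cons_append, List.nil_append, List.cons.injEq] at he
      obtain ⟨rfl, rfl, rfl, _⟩ := he
      exact hl _ x y z h₁
    | _ :: _ :: _ :: _ :: _, he => simp at he

theorem List.Perm.range'_of_append {A B : List ℕ} {o n : ℕ} (h : (A ++ B).Perm (List.range' o n))
    (hAB : ∀ x ∈ A, ∀ y ∈ B, y < x) :
    A.Perm (List.range' (o + B.length) A.length) ∧ B.Perm (List.range' o B.length) := by
  have hn : A.length + B.length = n := by simpa using h.length_eq
  have hnd : (A ++ B).Nodup := h.nodup_iff.2 (List.nodup_range')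
  have hmem : ∀ x, (x ∈ A ∨ x ∈ B) ↔ o ≤ x ∧ x < o + n := by
    intro x
    rw [← List.mem_append, h.mem_iff, List.mem_range'_1]
  have hB : ∀ y ∈ B, o ≤ y ∧ y < o + B.length := by
    intro y hy
    have h1 := (hmem y).1 (.inr hy)
    refine ⟨h1.1, ?_⟩
    -- Letters of `A` exceed `y`, so all letters up to `y` lie in `B`; counting them bounds `y`.
    have hsub : List.range' o (y + 1 - o) ⊆ B := by
      intro x hx
      rw [List.mem_range'_1] at hx
      rcases (hmem x).2 (by omega) with hA | hB
      · have := hAB x hA y hy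
        omega
      · exact hB
    have := ((List.nodup_range').subperm hsub).length_le
    simp at this
    omega
  have hBp : B.Perm (List.range' o B.length) := by
    refine ((hnd.of_append_right).subperm fun y hy => ?_).perm_of_length_le (by simp)
    simpa [List.mem_range'_1] using hB y hy
  refine ⟨?_, hBp⟩
  refine ((hnd.of_append_left).subperm fun x hx => ?_).perm_of_length_le (by simp)
  rw [List.mem_range'_1]
  have h1 := (hmem x).1 (.inl hx)
  refine ⟨?_, by omega⟩
  by_contra hlt
  have hxB : x ∈ B := by
    rw [hBp.mem_iff, List.mem_range'_1]
    omega
  exact lt_irrefl x (hAB x hx x hxB)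

theorem exists_treeWord_eq {n o : ℕ} {w : List ℕ} (hp : w.Perm (List.range' o n))
    (ha : Avoids132 w) : ∃ t : BinaryTree Unit, t.numNodes = n ∧ treeWord t o = w := by
  induction n using Nat.strong_induction_on generalizing o w with
  | _ n ih =>
    rcases n with _ | n
    · exact ⟨.nil, rfl, by simpa [treeWord] using hp.symm⟩
    · have hmem : o + n ∈ w := by rw [hp.mem_iff, List.mem_range'_1]; omega
      obtain ⟨A, B, rfl⟩ := List.append_of_mem hmem
      have hnd : (A ++ (o + n) :: B).Nodup := hp.nodup_iff.2 List.nodup_range'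
      have hp' : (A ++ B).Perm (List.range' o n) := by
        rw [List.range'_concat] at hp
        have := (List.perm_middle.symm.trans hp).trans
          (List.perm_append_comm (l₁ := List.range' o n))
        simpa using this
      have hlen : A.length + B.length = n := by simpa using hp'.length_eq
      have hlt : ∀ v ∈ A ++ B, v < o + n := fun v hv => by
        have := hp'.mem_iff.1 hv
        rw [List.mem_range'_1] at this
        exact this.2
      have hAB : ∀ x ∈ A, ∀ y ∈ B, y < x := by
        intro x hx y hy
        -- The largest letter plays the role of the 3 in 132.
        have h1 := ha x (o + n) y ((List.singleton_sublist.2 hx).append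
          ((List.singleton_sublist.2 hy).cons_cons _))
        have h2 := hlt y (by simp [hy])
        have h3 : x ≠ y := by
          rintro rfl
          exact (List.disjoint_of_nodup_append hnd) hx (by simp [hy])
        omega
      obtain ⟨hA, hB⟩ := hp'.range'_of_append hAB
      obtain ⟨l, hl, rfl⟩ := ih A.length (by omega) hA
        fun x y z h => ha x y z (h.trans (List.sublist_append_left _ _))
      obtain ⟨r, hr, rfl⟩ := ih B.length (by omega) hB
        fun x y z h => ha x y z (h.trans ((List.sublist_cons_self _ _).trans
          (List.sublist_append_right _ _)))
      refine ⟨.node () l r, by simp; omega, ?_⟩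
      simp [treeWord, hl, hr, hlen]

theorem treeWord_injective {t t' : BinaryTree Unit} {o : ℕ}
    (h : treeWord t o = treeWord t' o) : t = t' := by
  induction t generalizing t' o with
  | nil =>
    cases t' with
    | nil => rfl
    | node => simp [treeWord] at h
  | node _ l r hl hr =>
    cases t' with
    | nil => simp [treeWord] at h
    | node _ l' r' =>
      have hn : l.numNodes + r.numNodes = l'.numNodes + r'.numNodes := by
        simpa [length_treeWord] using congrArg List.length h
      simp only [treeWord, List.append_assoc, List.singleton_append, ← hn] at h
      obtain ⟨h1, h2⟩ := (List.append_cons_inj_of_notMem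
        (fun hx => by have := mem_treeWord.1 hx; omega)
        (fun hx => by have := mem_treeWord.1 hx; omega)).1 h
      obtain rfl := hr h2.2
      rw [hl h1]

/-! ### Passage from permutations to words and trees -/

theorem List.ofFn_sublist_ofFn_iff {α : Type*} {m n : ℕ} {f : Fin n → α} {g : Fin m → α} :
    (List.ofFn g).Sublist (List.ofFn f) ↔
      ∃ i : Fin m → Fin n, StrictMono i ∧ ∀ j, g j = f (i j) := by
  rw [List.sublist_iff_exists_fin_orderEmbedding_get_eq]
  constructor
  · rintro ⟨e, he⟩
    refine ⟨fun j => (e (j.cast (by simp))).cast (by simp), ?_, fun j => ?_⟩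
    · intro a b hab
      have : e (a.cast (by simp)) < e (b.cast (by simp)) := e.strictMono (by simpa using hab)
      simpa using this
    · have := he (j.cast (by simp))
      simp only [List.get_eq_getElem, List.getElem_ofFn] at this
      exact this
  · rintro ⟨i, hi, h⟩
    refine ⟨OrderEmbedding.ofStrictMono (fun j => (i (j.cast (by simp))).cast (by simp)) ?_, ?_⟩
    · intro a b hab
      have : i (a.cast (by simp)) < i (b.cast (by simp)) := hi (by simpa using hab)
      simpa using this
    · intro j
      simp only [List.get_eq_getElem, List.getElem_ofFn]
      exact h (j.cast (by simp))

/-- One-line notation of a permutation, as a list of natural numbers. -/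
def permWord {n : ℕ} (σ : Equiv.Perm (Fin n)) : List ℕ := List.ofFn fun i => (σ i : ℕ)

theorem permWord_injective (n : ℕ) : Function.Injective (permWord (n := n)) := by
  intro σ τ h
  ext i
  exact congrFun (List.ofFn_injective h) i

theorem permWord_perm {n : ℕ} (σ : Equiv.Perm (Fin n)) :
    (permWord σ).Perm (List.range' 0 n) := by
  have h := σ.ofFn_comp_perm (fun i : Fin n => (i : ℕ))
  have e : List.ofFn (fun i : Fin n => (i : ℕ)) = List.range' 0 n :=
    List.ext_getElem (by simp) (by simp)
  exact e ▸ h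

theorem exists_permWord_eq {n : ℕ} {w : List ℕ} (h : w.Perm (List.range' 0 n)) :
    ∃ σ : Equiv.Perm (Fin n), permWord σ = w := by
  have hl : w.length = n := by simpa using h.length_eq
  have hlt : ∀ i : Fin n, w[i] < n := fun i => by
    have := h.mem_iff.1 (List.getElem_mem (by omega : (i : ℕ) < w.length))
    simpa [List.mem_range'_1] using this
  have hinj : Function.Injective fun i : Fin n => (⟨w[i], hlt i⟩ : Fin n) := by
    intro i j hij
    have hnd : w.Nodup := h.nodup_iff.2 List.nodup_range'
    have : w[i] = w[j] := by simpa using hij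
    exact Fin.ext (hnd.getElem_inj_iff.1 this)
  refine ⟨Equiv.ofBijective _ (Finite.injective_iff_bijective.1 hinj), ?_⟩
  apply List.ext_getElem
  · simp [permWord, hl]
  · intro i h1 h2
    simp [permWord]

theorem containsPattern_perm132_iff {n : ℕ} (σ : Equiv.Perm (Fin n)) :
    ContainsPattern perm132 σ ↔ ¬ Avoids132 (permWord σ) := by
  have key : ∀ i : Fin 3 → Fin n, (∀ j k, σ (i j) < σ (i k) ↔ perm132 j < perm132 k) ↔
      (σ (i 0) < σ (i 2) ∧ σ (i 2) < σ (i 1)) := by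
    intro i
    have e0 : perm132 0 = 0 := by decide
    have e1 : perm132 1 = 2 := by decide
    have e2 : perm132 2 = 1 := by decide
    simp only [Fin.forall_fin_succ, IsEmpty.forall_iff, and_true,
      Fin.succ_zero_eq_one, Fin.succ_one_eq_two, e0, e1, e2, lt_self_iff_false]
    simp only [Fin.lt_def]
    constructor
    · rintro h
      simp at h
      omega
    · rintro ⟨h1, h2⟩
      simp
      omega
  simp only [Avoids132, not_forall, not_not, ContainsPattern]
  constructor
  · rintro ⟨i, hi, h⟩
    have := (key i).1 h
    refine ⟨σ (i 0), σ (i 1), σ (i 2), ?_, this⟩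
    have := (List.ofFn_sublist_ofFn_iff (f := fun i => (σ i : ℕ))
      (g := fun j => (σ (i j) : ℕ))).2 ⟨i, hi, fun _ => rfl⟩
    simpa [permWord, List.ofFn_succ] using this
  · rintro ⟨x, y, z, hs, h⟩
    have e : [x, y, z] = List.ofFn ![x, y, z] := by simp [List.ofFn_succ]
    rw [e, permWord, List.ofFn_sublist_ofFn_iff] at hs
    obtain ⟨i, hi, hj⟩ := hs
    refine ⟨i, hi, (key i).2 ?_⟩
    have h0 := hj 0
    have h1 := hj 1
    have h2 := hj 2
    simp only [Matrix.cons_val] at h0 h1 h2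
    simp only [Fin.lt_def]
    omega

theorem image_permWord_avoiders (n : ℕ) :
    (avoiders perm132 n).image permWord =
      (BinaryTree.treesOfNumNodesEq n).image (treeWord · 0) := by
  ext w
  simp only [Finset.mem_image, avoiders, Finset.mem_filter, Finset.mem_univ, true_and,
    containsPattern_perm132_iff, not_not, BinaryTree.mem_treesOfNumNodesEq]
  constructor
  · rintro ⟨σ, hσ, rfl⟩
    exact exists_treeWord_eq (permWord_perm σ) hσ
  · rintro ⟨t, rfl, rfl⟩
    obtain ⟨σ, hσ⟩ := exists_permWord_eq (treeWord_perm t 0)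
    exact ⟨σ, hσ ▸ avoids132_treeWord t 0, hσ⟩

theorem sum_avoiders_perm132 (n : ℕ) (F : List ℕ → ℝ) :
    ∑ σ ∈ avoiders perm132 n, F (permWord σ) =
      ∑ t ∈ BinaryTree.treesOfNumNodesEq n, F (treeWord t 0) := by
  rw [← Finset.sum_image (f := F) ((permWord_injective n).injOn), image_permWord_avoiders,
    Finset.sum_image fun t _ t' _ h => treeWord_injective h]

theorem card_avoiders_perm132 (n : ℕ) : (avoiders perm132 n).card = catalan n := by
  rw [← BinaryTree.treesOfNumNodesEq_card_eq_catalan]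
  have := sum_avoiders_perm132 n fun _ => 1
  simpa using this

theorem repeatsPattern_UUUD_iff {n k : ℕ} (σ : Equiv.Perm (Fin n)) (i : Fin (k * 4 + 1) → Fin n) :
    RepeatsPattern patternUUUD σ k i ↔
      StrictMono i ∧ FollowsUUUD (List.ofFn fun j => (σ (i j) : ℕ)) := by
  have hV : ∀ (j : ℕ) (a b : Fin n), (patternUUUD (Fin.ofNat 4 j)).Holds a b ↔
      if 4 ∣ j + 1 then b < a else a < b := by
    intro j a b
    have h4 : j % 4 < 4 := Nat.mod_lt _ (by norm_num)
    have e : patternUUUD (Fin.ofNat 4 j) = patternUUUD ⟨j % 4, h4⟩ := rfl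
    have hd : 4 ∣ j + 1 ↔ j % 4 = 3 := by omega
    rw [e]
    simp only [hd]
    generalize j % 4 = r at h4
    interval_cases r <;> simp [patternUUUD, UpDown.Holds]
  refine and_congr_right fun _ => ?_
  constructor
  · intro h j hj
    simp only [List.length_ofFn] at hj
    have := (hV _ _ _).1 (h ⟨j, by omega⟩)
    simp only [List.getElem_ofFn]
    exact this
  · intro h j
    rw [hV]
    have := h j (by simp)
    simp only [List.getElem_ofFn] at this
    exact this

/-- Prefixes of a following list still follow the pattern, so the attained lengths are all `4k + 1 ≤
M` with `k ≥ 1`. -/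
theorem longestRepeat_UUUD {n M : ℕ} {σ : Equiv.Perm (Fin n)} (h : IsMaxUUUD (permWord σ) M) :
    longestRepeat patternUUUD σ = if M < 5 then 0 else 4 * ((M - 1) / 4) + 1 := by
  have hset : {m : ℕ | ∃ k : ℕ, 1 ≤ k ∧ m = k * 4 + 1 ∧
      ∃ i : Fin (k * 4 + 1) → Fin n, RepeatsPattern patternUUUD σ k i} =
      {m : ℕ | ∃ k : ℕ, 1 ≤ k ∧ m = k * 4 + 1 ∧ k * 4 + 1 ≤ M} := by
    ext m
    refine exists_congr fun k => and_congr_right fun _ => and_congr_right fun _ => ?_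
    simp only [repeatsPattern_UUUD_iff]
    constructor
    · rintro ⟨i, hi, hf⟩
      simpa using h.2 _ (List.ofFn_sublist_ofFn_iff.2 ⟨i, hi, fun _ => rfl⟩) hf
    · intro hk
      obtain ⟨⟨s, hs, hl, hf⟩, -⟩ := h
      have hl' : (s.take (k * 4 + 1)).length = k * 4 + 1 := by simp; omega
      have hs' := (List.take_sublist (k * 4 + 1) s).trans hs
      have hf' := hf.take (k * 4 + 1)
      generalize s.take (k * 4 + 1) = u at hl' hs' hf'
      obtain ⟨g, rfl⟩ : ∃ g : Fin (k * 4 + 1) → ℕ, u = List.ofFn g :=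
        ⟨fun j => u[j], List.ext_getElem (by simp only [hl', List.length_ofFn]) fun i _ _ => by
          simp only [List.getElem_ofFn, Fin.getElem_fin]⟩
      obtain ⟨i, hi, hg⟩ := List.ofFn_sublist_ofFn_iff.1 hs'
      refine ⟨i, hi, ?_⟩
      simpa only [← hg] using hf'
  rw [longestRepeat, hset]
  split_ifs with hM
  · refine (congrArg sSup (Set.eq_empty_of_forall_notMem ?_)).trans csSup_empty
    rintro m ⟨k, h1, -, h2⟩
    omega
  · refine IsGreatest.csSup_eq ⟨⟨(M - 1) / 4, by omega, by omega, by omega⟩, ?_⟩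
    rintro m ⟨k, -, rfl, hk⟩
    omega

theorem exists_treeWord_eq_permWord {n : ℕ} {σ : Equiv.Perm (Fin n)}
    (hσ : σ ∈ avoiders perm132 n) :
    ∃ t : BinaryTree Unit, t.numNodes = n ∧ treeWord t 0 = permWord σ := by
  refine exists_treeWord_eq (permWord_perm σ) ?_
  simpa [avoiders, containsPattern_perm132_iff] using hσ

open Classical in
theorem avoidExpect_longestRepeat (n : ℕ) :
    avoidExpect perm132 n (fun σ => (longestRepeat patternUUUD σ : ℝ)) =
      (∑ t ∈ BinaryTree.treesOfNumNodesEq n,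
        ((if treeMax t < 5 then 0 else 4 * ((treeMax t - 1) / 4) + 1 : ℕ) : ℝ)) / catalan n := by
  let len : ℕ → ℕ := fun M => if M < 5 then 0 else 4 * ((M - 1) / 4) + 1
  -- The length is expressed through the word alone, so that the sum can be transported to trees;
  -- the value 0 is never used.
  let F : List ℕ → ℝ := fun w =>
    if h : ∃ M, IsMaxUUUD w M then (len h.choose : ℝ) else 0
  have hF : ∀ {w M}, IsMaxUUUD w M → F w = len M := by
    intro w M h
    have hex : ∃ M, IsMaxUUUD w M := ⟨M, h⟩
    have : hex.choose = M := by
      obtain ⟨⟨s, hs, hl, hf⟩, hmax⟩ := hex.choose_spec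
      obtain ⟨⟨s', hs', hl', hf'⟩, hmax'⟩ := h
      exact le_antisymm (hl ▸ hmax' s hs hf) (hl' ▸ hmax s' hs' hf')
    simp only [F, dif_pos hex, this]
  rw [avoidExpect, card_avoiders_perm132]
  congr 1
  have := sum_avoiders_perm132 n F
  simp only [hF (isMaxUUUD_treeWord _ 0)] at this
  rw [← this]
  refine Finset.sum_congr rfl fun σ hσ => ?_
  obtain ⟨t, -, ht⟩ := exists_treeWord_eq_permWord hσ
  have hm := ht ▸ isMaxUUUD_treeWord t 0
  rw [hF hm, longestRepeat_UUUD hm]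

/-! ### Limits of weighted sums; Catalan and central binomial numbers -/

-- Fatou's inequality: a finite partial sum of the limit series already exceeds `b`, and the
-- remaining terms are nonnegative.
open Topology in
theorem eventually_lt_sum_mul_of_tendsto {a : ℕ → ℕ → ℝ} {α g : ℕ → ℝ} (ha : ∀ n m, 0 ≤ a n m)
    (hlim : ∀ m, Tendsto (a · m) atTop (𝓝 (α m))) (hg : ∀ m, 0 ≤ g m)
    (hs : Summable fun m => g m * α m) {b : ℝ} (hb : b < ∑' m, g m * α m) :
    ∀ᶠ n in atTop, b < ∑ m ∈ Finset.range (n + 1), g m * a n m := by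
  obtain ⟨K, hK⟩ := (hs.hasSum.tendsto_sum_nat.eventually_const_lt hb).exists
  have h1 : Tendsto (fun n => ∑ m ∈ Finset.range K, g m * a n m) atTop
      (𝓝 (∑ m ∈ Finset.range K, g m * α m)) :=
    tendsto_finsetSum _ fun m _ => (hlim m).const_mul _
  filter_upwards [h1.eventually_const_lt hK, eventually_ge_atTop K] with n hn hKn
  refine hn.trans_le (Finset.sum_le_sum_of_subset_of_nonneg ?_ fun m _ _ =>
    mul_nonneg (hg m) (ha n m))
  exact Finset.range_subset_range.2 (by omega)

open Topology in
/-- A generalized dominated convergence theorem for triangular weighted sums: the dominating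
sequence depends on `n`, but its sums converge to the expected limit. -/
theorem tendsto_sum_mul_of_le {a : ℕ → ℕ → ℝ} {α c g : ℕ → ℝ} (ha : ∀ n m, 0 ≤ a n m)
    (hlim : ∀ m, Tendsto (a · m) atTop (𝓝 (α m))) (hg : ∀ m, 0 ≤ g m) (hgc : ∀ m, g m ≤ c m)
    (hgs : Summable fun m => g m * α m) (hcs : Summable fun m => c m * α m)
    (hc : Tendsto (fun n => ∑ m ∈ Finset.range (n + 1), c m * a n m) atTop
      (𝓝 (∑' m, c m * α m))) :
    Tendsto (fun n => ∑ m ∈ Finset.range (n + 1), g m * a n m) atTop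
      (𝓝 (∑' m, g m * α m)) := by
  refine tendsto_order.2 ⟨fun b hb => eventually_lt_sum_mul_of_tendsto ha hlim hg hgs hb,
    fun b hb => ?_⟩
  set S := ∑' m, g m * α m
  set C := ∑' m, c m * α m
  have hd : Summable fun m => (c m - g m) * α m := by
    simpa only [sub_mul] using hcs.sub hgs
  have hdS : ∑' m, (c m - g m) * α m = C - S := by
    simp only [sub_mul]
    exact hcs.tsum_sub hgs
  -- Fatou for `c - g`, combined with convergence for `c`, gives the upper bound for `g`.
  have h1 := eventually_lt_sum_mul_of_tendsto ha hlim (fun m => sub_nonneg.2 (hgc m)) hd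
    (b := C - S - (b - S) / 2) (by rw [hdS]; linarith)
  have h2 := hc.eventually_lt_const (show C < C + (b - S) / 2 by linarith)
  filter_upwards [h1, h2] with n h1 h2
  simp only [sub_mul, Finset.sum_sub_distrib] at h1
  linarith

theorem catalan_cast_mul_succ (n : ℕ) : (catalan n : ℝ) * (n + 1) = n.centralBinom := by
  rw [← succ_mul_catalan_eq_centralBinom]
  push_cast
  ring

theorem catalan_cast_pos (n : ℕ) : (0 : ℝ) < catalan n := by
  have h0 : (0 : ℝ) < n.centralBinom := by exact_mod_cast n.centralBinom_pos
  rw [← catalan_cast_mul_succ] at h0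
  exact pos_of_mul_pos_left h0 (by positivity)

theorem centralBinom_succ_cast (n : ℕ) :
    ((n + 1).centralBinom : ℝ) = 2 * (2 * n + 1) * catalan n := by
  have h : ((n : ℝ) + 1) * (n + 1).centralBinom = 2 * (2 * n + 1) * n.centralBinom := by
    exact_mod_cast Nat.succ_mul_centralBinom_succ n
  rw [← catalan_cast_mul_succ n] at h
  have h0 : (n : ℝ) + 1 ≠ 0 := by positivity
  refine mul_left_cancel₀ h0 (h.trans (by ring))

/-- Symmetrise the convolution: the weights `i + 1` and `j + 1` add up to `n + 2`, leaving the
Catalan recursion. -/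
theorem sum_catalan_mul_centralBinom (n : ℕ) :
    2 * ∑ ij ∈ Finset.HasAntidiagonal.antidiagonal n, (catalan ij.1 : ℝ) * ij.2.centralBinom =
      (n + 1).centralBinom := by
  have e : ∑ ij ∈ Finset.HasAntidiagonal.antidiagonal n, (catalan ij.1 : ℝ) * ij.2.centralBinom =
      ∑ ij ∈ Finset.HasAntidiagonal.antidiagonal n, (catalan ij.2 : ℝ) * ij.1.centralBinom :=
    (Finset.Nat.sum_antidiagonal_swap (f := fun ij => (catalan ij.2 : ℝ) * ij.1.centralBinom))
  have h : ((n + 1).centralBinom : ℝ) =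
      (n + 2) * ∑ ij ∈ Finset.HasAntidiagonal.antidiagonal n, (catalan ij.1 : ℝ) * catalan ij.2 := by
    rw [← catalan_cast_mul_succ, catalan_succ']
    push_cast
    ring
  rw [two_mul]
  nth_rewrite 2 [e]
  rw [h, ← Finset.sum_add_distrib, Finset.mul_sum]
  refine Finset.sum_congr rfl fun ij hij => ?_
  have hn : (ij.1 : ℝ) + ij.2 = n := by exact_mod_cast Finset.HasAntidiagonal.mem_antidiagonal.1 hij
  rw [← catalan_cast_mul_succ, ← catalan_cast_mul_succ, ← hn]
  ring

theorem summable_catalan_div_four_pow : Summable fun n => (catalan n : ℝ) * (1 / 4) ^ n := by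
  -- The partial sums telescope.
  have h : ∀ N, ∑ m ∈ Finset.range N, (catalan m : ℝ) * (1 / 4) ^ m =
      2 - 2 * N.centralBinom * (1 / 4) ^ N := by
    intro N
    induction N with
    | zero => simp
    | succ N ih =>
      rw [Finset.sum_range_succ, ih, centralBinom_succ_cast, ← catalan_cast_mul_succ, pow_succ]
      ring
  refine summable_of_sum_range_le (c := 2) (fun n => by positivity) fun N => ?_
  rw [h]
  have : (0 : ℝ) ≤ 2 * N.centralBinom * (1 / 4) ^ N := by positivity
  linarith

/-- The Catalan recursion gives `S = 1 + S² / 4`, whose only root is the double root 2. -/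
theorem tsum_catalan_div_four_pow : ∑' n, (catalan n : ℝ) * (1 / 4) ^ n = 2 := by
  have hs := summable_catalan_div_four_pow
  have hn : Summable fun n => ‖(catalan n : ℝ) * (1 / 4) ^ n‖ := hs.norm
  have h := tsum_mul_tsum_eq_tsum_sum_antidiagonal_of_summable_norm hn hn
  have h1 := hs.tsum_eq_zero_add
  have h2 : ∀ n, ∑ kl ∈ Finset.HasAntidiagonal.antidiagonal n,
      (catalan kl.1 : ℝ) * (1 / 4) ^ kl.1 * (catalan kl.2 * (1 / 4) ^ kl.2) =
      4 * (catalan (n + 1) * (1 / 4) ^ (n + 1)) := by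
    intro n
    rw [catalan_succ']
    push_cast
    rw [Finset.sum_mul, Finset.mul_sum]
    refine Finset.sum_congr rfl fun kl hkl => ?_
    rw [← Finset.HasAntidiagonal.mem_antidiagonal.1 hkl, pow_succ, pow_add]
    ring
  simp only [h2, tsum_mul_left] at h
  simp only [catalan_zero, Nat.cast_one, pow_zero, mul_one] at h1
  have : (∑' n, (catalan n : ℝ) * (1 / 4) ^ n - 2) ^ 2 = 0 := by linarith
  linarith [pow_eq_zero_iff (two_ne_zero) |>.1 this]

open Topology in
theorem tendsto_natCast_mul_add_div (a b c d : ℝ) (hc : c ≠ 0) :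
    Tendsto (fun n : ℕ => (a * n + b) / (c * n + d)) atTop (𝓝 (a / c)) := by
  have h : ∀ a b : ℝ, Tendsto (fun n : ℕ => a + b * (n : ℝ)⁻¹) atTop (𝓝 a) := fun a b => by
    simpa using (tendsto_inv_atTop_nhds_zero_nat (𝕜 := ℝ)).const_mul b |>.const_add a
  refine ((h a b).div (h c d) hc).congr' ?_
  filter_upwards [eventually_ne_atTop 0] with n hn
  have hn' : (n : ℝ) ≠ 0 := by exact_mod_cast hn
  rw [Pi.div_apply, ← mul_div_mul_right _ (c + d * (n : ℝ)⁻¹) hn']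
  congr 1 <;> field_simp

open Topology in
theorem tendsto_centralBinom_div (m : ℕ) :
    Tendsto (fun n : ℕ => ((n - m).centralBinom : ℝ) / n.centralBinom) atTop
      (𝓝 ((1 / 4) ^ m)) := by
  rw [← tendsto_add_atTop_iff_nat m]
  simp only [Nat.add_sub_cancel]
  induction m with
  | zero =>
    have : ∀ n : ℕ, (n.centralBinom : ℝ) ≠ 0 := fun n => by exact_mod_cast n.centralBinom_ne_zero
    simp [this]
  | succ m ih =>
    have h1 : Tendsto (fun n : ℕ => (n.centralBinom : ℝ) / (n + 1).centralBinom) atTop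
        (𝓝 (1 / 4)) := by
      refine (tendsto_natCast_mul_add_div 1 1 4 2 (by norm_num)).congr fun n => ?_
      have h0 : (n.centralBinom : ℝ) ≠ 0 := by exact_mod_cast n.centralBinom_ne_zero
      rw [← catalan_cast_mul_succ] at h0 ⊢
      rw [centralBinom_succ_cast]
      have := left_ne_zero_of_mul h0
      field_simp
      ring
    rw [pow_succ]
    refine (ih.mul (h1.comp (tendsto_add_atTop_nat m))).congr fun n => ?_
    have h0 : ((n + m).centralBinom : ℝ) ≠ 0 := by exact_mod_cast (n + m).centralBinom_ne_zero
    exact div_mul_div_cancel₀ h0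

/-! ### Sums over trees and their series at `1/4` -/

/-- The sum of `φ` over the binary trees with `n` nodes. -/
noncomputable def treeSum (φ : BinaryTree Unit → ℝ) (n : ℕ) : ℝ :=
  ∑ t ∈ BinaryTree.treesOfNumNodesEq n, φ t

theorem treeSum_zero (φ : BinaryTree Unit → ℝ) : treeSum φ 0 = φ .nil := by
  simp [treeSum]

theorem treeSum_one (n : ℕ) : treeSum (fun _ => 1) n = catalan n := by
  simp [treeSum, BinaryTree.treesOfNumNodesEq_card_eq_catalan]

theorem treeSum_succ (φ : BinaryTree Unit → ℝ) (n : ℕ) :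
    treeSum φ (n + 1) = ∑ ij ∈ Finset.HasAntidiagonal.antidiagonal n,
      ∑ l ∈ BinaryTree.treesOfNumNodesEq ij.1, ∑ r ∈ BinaryTree.treesOfNumNodesEq ij.2,
        φ (.node () l r) := by
  rw [treeSum, BinaryTree.treesOfNumNodesEq_succ, Finset.sum_biUnion]
  · refine Finset.sum_congr rfl fun ij _ => ?_
    rw [Finset.sum_map, Finset.sum_product]
    rfl
  · simp_rw [Set.PairwiseDisjoint, Set.Pairwise, Finset.disjoint_left]
    aesop

theorem treeSum_succ_eq_sum_mul {K : ℕ} {φ : BinaryTree Unit → ℝ} {κ : Fin K → ℝ}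
    {α β : Fin K → BinaryTree Unit → ℝ}
    (h : ∀ l r, φ (.node () l r) = ∑ k, κ k * (α k l * β k r)) (n : ℕ) :
    treeSum φ (n + 1) = ∑ k, κ k * ∑ ij ∈ Finset.HasAntidiagonal.antidiagonal n,
      treeSum (α k) ij.1 * treeSum (β k) ij.2 := by
  rw [treeSum_succ]
  simp only [h, treeSum, Finset.sum_mul_sum]
  simp only [Finset.mul_sum]
  rw [Finset.sum_comm (s := Finset.univ)]
  refine Finset.sum_congr rfl fun ij _ => ?_
  rw [Finset.sum_comm (s := Finset.univ)]
  refine Finset.sum_congr rfl fun l _ => ?_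
  rw [Finset.sum_comm]

theorem abs_treeSum_le {φ : BinaryTree Unit → ℝ} (h : ∀ t, |φ t| ≤ 1) (n : ℕ) :
    |treeSum φ n| ≤ catalan n := by
  rw [← treeSum_one]
  exact (Finset.abs_sum_le_sum_abs _ _).trans (Finset.sum_le_sum fun t _ => h t)

/-- The sum of `φ` over all binary trees, weighted by `4⁻¹` to the power of the number of nodes. -/
noncomputable def treeSeries (φ : BinaryTree Unit → ℝ) : ℝ :=
  ∑' n, treeSum φ n * (1 / 4) ^ n

theorem summable_treeSum {φ : BinaryTree Unit → ℝ} (h : ∀ t, |φ t| ≤ 1) :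
    Summable fun n => ‖treeSum φ n * (1 / 4) ^ n‖ := by
  refine summable_catalan_div_four_pow.of_nonneg_of_le (fun _ => norm_nonneg _) fun n => ?_
  rw [norm_mul, Real.norm_eq_abs, Real.norm_of_nonneg (by positivity)]
  gcongr
  exact abs_treeSum_le h n

/-- Cauchy products of absolutely convergent series; the root contributes the factor `1/4`. -/
theorem treeSeries_eq {K : ℕ} {φ : BinaryTree Unit → ℝ} {κ : Fin K → ℝ}
    {α β : Fin K → BinaryTree Unit → ℝ} (hφ : ∀ t, |φ t| ≤ 1)
    (hα : ∀ k t, |α k t| ≤ 1) (hβ : ∀ k t, |β k t| ≤ 1)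
    (h : ∀ l r, φ (.node () l r) = ∑ k, κ k * (α k l * β k r)) :
    treeSeries φ = φ .nil + 1 / 4 * ∑ k, κ k * (treeSeries (α k) * treeSeries (β k)) := by
  rw [treeSeries, (summable_treeSum hφ).of_norm.tsum_eq_zero_add, treeSum_zero, pow_zero, mul_one]
  congr 1
  have h1 : ∀ k, treeSeries (α k) * treeSeries (β k) = ∑' n, ∑ ij ∈ Finset.HasAntidiagonal.antidiagonal n,
      treeSum (α k) ij.1 * (1 / 4) ^ ij.1 * (treeSum (β k) ij.2 * (1 / 4) ^ ij.2) := fun k =>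
    tsum_mul_tsum_eq_tsum_sum_antidiagonal_of_summable_norm (summable_treeSum (hα k))
      (summable_treeSum (hβ k))
  have h2 : ∀ k, Summable fun n => ∑ ij ∈ Finset.HasAntidiagonal.antidiagonal n,
      treeSum (α k) ij.1 * (1 / 4) ^ ij.1 * (treeSum (β k) ij.2 * (1 / 4) ^ ij.2) := fun k =>
    (summable_norm_sum_mul_antidiagonal_of_summable_norm (summable_treeSum (hα k))
      (summable_treeSum (hβ k))).of_norm
  simp only [h1]
  simp only [← tsum_mul_left]
  rw [← Summable.tsum_finsetSum fun k _ => (h2 k).mul_left (κ k), ← tsum_mul_left]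
  congr 1 with n
  rw [treeSum_succ_eq_sum_mul h, Finset.sum_mul, Finset.mul_sum]
  refine Finset.sum_congr rfl fun k _ => ?_
  simp only [Finset.sum_mul, Finset.mul_sum]
  refine Finset.sum_congr rfl fun ij hij => ?_
  rw [← Finset.HasAntidiagonal.mem_antidiagonal.1 hij, pow_succ, pow_add]
  ring

/-! ### The linear system for the residues of `treeMax` -/

/-- The indicator of the trees with `treeMax` equal to `k`. -/
def maxEq (k : ℕ) (t : BinaryTree Unit) : ℝ := if treeMax t = k then 1 else 0

/-- The indicator of the trees with `treeMax` congruent to `k` modulo `4`. -/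
def maxMod (k : ℕ) (t : BinaryTree Unit) : ℝ := if treeMax t % 4 = k then 1 else 0

theorem abs_maxEq_le (k : ℕ) (t : BinaryTree Unit) : |maxEq k t| ≤ 1 := by
  unfold maxEq; split_ifs <;> simp

theorem abs_maxMod_le (k : ℕ) (t : BinaryTree Unit) : |maxMod k t| ≤ 1 := by
  unfold maxMod; split_ifs <;> simp

theorem maxEq_zero_node (l r : BinaryTree Unit) : maxEq 0 (.node () l r) = 0 := by
  simp only [maxEq, treeMax]
  split_ifs <;> first | rfl | omega

theorem maxEq_one_node (l r : BinaryTree Unit) :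
    maxEq 1 (.node () l r) = maxEq 0 l * maxEq 0 r + maxEq 0 l * maxEq 1 r := by
  simp only [maxEq, treeMax]
  grind

theorem maxEq_two_node (l r : BinaryTree Unit) :
    maxEq 2 (.node () l r) = maxEq 1 l * maxEq 0 r + maxEq 1 l * maxEq 1 r +
      maxEq 1 l * maxEq 2 r + maxEq 0 l * maxEq 2 r := by
  simp only [maxEq, treeMax]
  grind

/-- With `a` the value after adding the root to `l`, the residue is that of `r` unless `treeMax r <
a % 4`. As `a % 4 ≤ 3`, only the exact values 0, 1, 2 of `treeMax r` need correction terms. -/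
theorem maxMod_one_node (l r : BinaryTree Unit) :
    maxMod 1 (.node () l r) = maxMod 1 r - maxMod 1 l * maxEq 1 r - maxMod 2 l * maxEq 1 r +
      maxEq 0 l * maxEq 0 r := by
  simp only [maxEq, maxMod, treeMax]
  grind

theorem maxMod_two_node (l r : BinaryTree Unit) :
    maxMod 2 (.node () l r) = maxMod 2 r - maxMod 2 l * maxEq 2 r + maxMod 1 l * maxEq 0 r +
      maxMod 1 l * maxEq 1 r := by
  simp only [maxEq, maxMod, treeMax]
  grind

theorem maxMod_three_node (l r : BinaryTree Unit) :
    maxMod 3 (.node () l r) = maxMod 3 r + maxMod 2 l * maxEq 0 r + maxMod 2 l * maxEq 1 r +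
      maxMod 2 l * maxEq 2 r := by
  simp only [maxEq, maxMod, treeMax]
  grind

/-- The root letter completes a period exactly when the left maximum is 3 modulo 4. -/
theorem treeMax_div_four_node (l r : BinaryTree Unit) :
    ((treeMax (.node () l r) / 4 : ℕ) : ℝ) =
      (treeMax l / 4 : ℕ) + (treeMax r / 4 : ℕ) + maxMod 3 l := by
  have h : treeMax (.node () l r) / 4 =
      treeMax l / 4 + treeMax r / 4 + if treeMax l % 4 = 3 then 1 else 0 := by
    simp only [treeMax]
    split_ifs <;> omega
  rw [h, maxMod]
  push_cast
  rfl

theorem treeSeries_one : treeSeries (fun _ => 1) = 2 := by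
  simp only [treeSeries, treeSum_one, tsum_catalan_div_four_pow]

theorem treeSeries_maxEq_zero : treeSeries (maxEq 0) = 1 := by
  have h := treeSeries_eq (κ := (![] : Fin 0 → ℝ)) (α := ![]) (β := ![]) (abs_maxEq_le 0)
    (fun k => k.elim0) (fun k => k.elim0) fun l r => by simp [maxEq_zero_node]
  simpa [maxEq, treeMax] using h

theorem treeSeries_maxEq_one : treeSeries (maxEq 1) = 1 / 3 := by
  have h := treeSeries_eq (κ := ![1, 1]) (α := ![maxEq 0, maxEq 0]) (β := ![maxEq 0, maxEq 1])
    (abs_maxEq_le 1) (by simp [Fin.forall_fin_succ, abs_maxEq_le])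
    (by simp [Fin.forall_fin_succ, abs_maxEq_le])
    fun l r => by simp [maxEq_one_node]
  have h0 : maxEq 1 .nil = 0 := by simp [maxEq, treeMax]
  simp only [Fin.sum_univ_two, Matrix.cons_val_zero, Matrix.cons_val_one, h0,
    treeSeries_maxEq_zero] at h
  linarith

theorem treeSeries_maxEq_two : treeSeries (maxEq 2) = 1 / 6 := by
  have h := treeSeries_eq (κ := ![1, 1, 1, 1]) (α := ![maxEq 1, maxEq 1, maxEq 1, maxEq 0])
    (β := ![maxEq 0, maxEq 1, maxEq 2, maxEq 2])
    (abs_maxEq_le 2) (by simp [Fin.forall_fin_succ, abs_maxEq_le])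
    (by simp [Fin.forall_fin_succ, abs_maxEq_le])
    fun l r => by simp [maxEq_two_node, Fin.sum_univ_four]
  have h0 : maxEq 2 .nil = 0 := by simp [maxEq, treeMax]
  simp only [Fin.sum_univ_four, Matrix.cons_val, h0,
    treeSeries_maxEq_zero, treeSeries_maxEq_one] at h
  linarith

theorem treeSeries_maxMod_one : 2 * treeSeries (maxMod 1) =
    1 - (treeSeries (maxMod 1) + treeSeries (maxMod 2)) / 3 := by
  have h := treeSeries_eq (κ := ![1, -1, -1, 1])
    (α := ![fun _ => 1, maxMod 1, maxMod 2, maxEq 0])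
    (β := ![maxMod 1, maxEq 1, maxEq 1, maxEq 0])
    (abs_maxMod_le 1) (by simp [Fin.forall_fin_succ, abs_maxEq_le, abs_maxMod_le])
    (by simp [Fin.forall_fin_succ, abs_maxEq_le, abs_maxMod_le])
    fun l r => by simp [maxMod_one_node, Fin.sum_univ_four]; ring
  have h0 : maxMod 1 .nil = 0 := by simp [maxMod, treeMax]
  simp only [Fin.sum_univ_four, Matrix.cons_val, h0, treeSeries_one,
    treeSeries_maxEq_zero, treeSeries_maxEq_one] at h
  linarith

theorem treeSeries_maxMod_two : 2 * treeSeries (maxMod 2) =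
    4 / 3 * treeSeries (maxMod 1) - treeSeries (maxMod 2) / 6 := by
  have h := treeSeries_eq (κ := ![1, -1, 1, 1])
    (α := ![fun _ => 1, maxMod 2, maxMod 1, maxMod 1])
    (β := ![maxMod 2, maxEq 2, maxEq 0, maxEq 1])
    (abs_maxMod_le 2) (by simp [Fin.forall_fin_succ, abs_maxMod_le])
    (by simp [Fin.forall_fin_succ, abs_maxEq_le, abs_maxMod_le])
    fun l r => by simp [maxMod_two_node, Fin.sum_univ_four]; ring
  have h0 : maxMod 2 .nil = 0 := by simp [maxMod, treeMax]
  simp only [Fin.sum_univ_four, Matrix.cons_val, h0, treeSeries_one,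
    treeSeries_maxEq_zero, treeSeries_maxEq_one, treeSeries_maxEq_two] at h
  linarith

theorem treeSeries_maxMod_three : treeSeries (maxMod 3) = 2 / 11 := by
  have h := treeSeries_eq (κ := ![1, 1, 1, 1])
    (α := ![fun _ => 1, maxMod 2, maxMod 2, maxMod 2])
    (β := ![maxMod 3, maxEq 0, maxEq 1, maxEq 2])
    (abs_maxMod_le 3) (by simp [Fin.forall_fin_succ, abs_maxMod_le])
    (by simp [Fin.forall_fin_succ, abs_maxEq_le, abs_maxMod_le])
    fun l r => by simp [maxMod_three_node, Fin.sum_univ_four]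
  have h0 : maxMod 3 .nil = 0 := by simp [maxMod, treeMax]
  simp only [Fin.sum_univ_four, Matrix.cons_val, h0, treeSeries_one,
    treeSeries_maxEq_zero, treeSeries_maxEq_one, treeSeries_maxEq_two] at h
  linarith [treeSeries_maxMod_one, treeSeries_maxMod_two]

/-! ### The generating function of `treeMax / 4` and its asymptotics -/

open PowerSeries in
theorem two_mul_treeSum_treeMax_div_four (n : ℕ) :
    2 * treeSum (fun t => ((treeMax t / 4 : ℕ) : ℝ)) n =
      (∑ m ∈ Finset.range (n + 1), treeSum (maxMod 3) m * (n - m).centralBinom) -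
        treeSum (maxMod 3) n := by
  let φ : BinaryTree Unit → ℝ := fun t => ((treeMax t / 4 : ℕ) : ℝ)
  let T : PowerSeries ℝ := mk (treeSum φ)
  let G : PowerSeries ℝ := mk (treeSum (maxMod 3))
  let K : PowerSeries ℝ := mk fun n => (catalan n : ℝ)
  let B : PowerSeries ℝ := mk fun n => (n.centralBinom : ℝ)
  have hB : B = 1 + X * (2 * (K * B)) := by
    ext n
    rcases n with _ | n
    · simp [B]
    · rw [map_add, coeff_succ_X_mul, ← map_ofNat (C (R := ℝ)), coeff_C_mul, coeff_mul]
      simp only [B, K, coeff_mk, coeff_one, Nat.succ_ne_zero, if_false, zero_add]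
      exact (sum_catalan_mul_centralBinom n).symm
  have hT : T = X * (T * K + K * T + G * K) := by
    ext n
    rcases n with _ | n
    · simp [T, treeSum_zero, φ, treeMax]
    · rw [coeff_succ_X_mul]
      simp only [map_add, coeff_mul, T, K, G, coeff_mk, ← treeSum_one]
      have := treeSum_succ_eq_sum_mul (φ := φ) (κ := ![1, 1, 1])
        (α := ![φ, fun _ => 1, maxMod 3]) (β := ![fun _ => 1, φ, fun _ => 1])
        (fun l r => by simp [Fin.sum_univ_three, φ, treeMax_div_four_node]) n
      simpa [Fin.sum_univ_three] using this
  have h : 2 * T = G * B - G := by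
    -- `B` inverts `1 - 2XK`, so `T = XGKB`, while `2XKB = B - 1`.
    linear_combination -(2 * T + G) * hB + (2 * B) * hT
  have hc := congrArg (coeff n) h
  rw [← map_ofNat (C (R := ℝ)), coeff_C_mul, map_sub, coeff_mul] at hc
  simp only [T, G, B, coeff_mk] at hc
  rw [hc, Finset.Nat.sum_antidiagonal_eq_sum_range_succ
    (fun i j => treeSum (maxMod 3) i * (j.centralBinom : ℝ))]

open Topology in
theorem tendsto_sum_maxMod_three :
    Tendsto (fun n : ℕ => ∑ m ∈ Finset.range (n + 1),
      treeSum (maxMod 3) m * (((n - m).centralBinom : ℝ) / n.centralBinom)) atTop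
      (𝓝 (2 / 11)) := by
  have hg : ∀ m, 0 ≤ treeSum (maxMod 3) m := fun m => Finset.sum_nonneg fun t _ => by
    unfold maxMod; split_ifs <;> simp
  rw [← treeSeries_maxMod_three]
  -- The Catalan numbers dominate, and their convolution with the central binomials has a closed
  -- form.
  refine tendsto_sum_mul_of_le (c := fun m => (catalan m : ℝ)) (fun n m => by positivity)
    tendsto_centralBinom_div hg
    (fun m => (le_abs_self _).trans (abs_treeSum_le (abs_maxMod_le 3) m))
    (summable_treeSum (abs_maxMod_le 3)).of_norm summable_catalan_div_four_pow ?_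
  rw [tsum_catalan_div_four_pow]
  have h := tendsto_natCast_mul_add_div 2 1 1 1 one_ne_zero
  norm_num only at h
  refine h.congr fun n => ?_
  have h0 : (n.centralBinom : ℝ) ≠ 0 := by exact_mod_cast n.centralBinom_ne_zero
  have h1 := sum_catalan_mul_centralBinom n
  rw [Finset.Nat.sum_antidiagonal_eq_sum_range_succ
    (fun i j => (catalan i : ℝ) * (j.centralBinom : ℝ)), centralBinom_succ_cast] at h1
  simp only [← mul_div_assoc, ← Finset.sum_div]
  rw [← catalan_cast_mul_succ] at h0 ⊢
  have h2 := left_ne_zero_of_mul h0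
  rw [show ∑ m ∈ Finset.range (n + 1), (catalan m : ℝ) * (n - m).centralBinom =
    (2 * n + 1) * catalan n by linarith]
  field_simp

open Topology in
theorem tendsto_treeSum_treeMax_div_four :
    Tendsto (fun n : ℕ => treeSum (fun t => ((treeMax t / 4 : ℕ) : ℝ)) n / catalan n / n) atTop
      (𝓝 (1 / 11)) := by
  have hc := catalan_cast_pos
  -- The factor `(n + 1) / (2n)` comes from `centralBinom n = (n + 1) catalan n`, the 2 in `2T` and
  -- the division by `n`.
  have h1 := ((tendsto_natCast_mul_add_div 1 1 2 0 two_ne_zero).mul tendsto_sum_maxMod_three)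
  have h2 : Tendsto (fun n : ℕ => treeSum (maxMod 3) n / catalan n / 2 * (n : ℝ)⁻¹) atTop
      (𝓝 0) := by
    refine bdd_le_mul_tendsto_zero' (1 / 2) (Eventually.of_forall fun n => ?_)
      tendsto_inv_atTop_nhds_zero_nat
    have := abs_treeSum_le (abs_maxMod_le 3) n
    rw [abs_div, abs_div, abs_of_pos (hc n), abs_two]
    gcongr
    exact (div_le_one (hc n)).2 this
  have h3 := h1.sub h2
  norm_num only at h3
  refine h3.congr' ?_
  filter_upwards [eventually_ne_atTop 0] with n hn
  have hn' : (n : ℝ) ≠ 0 := by exact_mod_cast hn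
  have h := two_mul_treeSum_treeMax_div_four n
  simp only [← mul_div_assoc, ← Finset.sum_div]
  rw [← catalan_cast_mul_succ]
  have hcn := (hc n).ne'
  have hn1 : (n : ℝ) + 1 ≠ 0 := by positivity
  rw [show treeSum (fun t => ((treeMax t / 4 : ℕ) : ℝ)) n = ((∑ m ∈ Finset.range (n + 1),
    treeSum (maxMod 3) m * (n - m).centralBinom) - treeSum (maxMod 3) n) / 2 by linarith]
  field_simp
  ring

theorem theorem2 :
    (∀ (n : ℕ) (σ : Equiv.Perm (Fin n)), σ ∈ avoiders perm132 n →
      longestRepeat patternUUUD σ = 0 ∨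
        ∃ k : ℕ, 1 ≤ k ∧ longestRepeat patternUUUD σ = 4 * k + 1) ∧
    (fun n : ℕ => avoidExpect perm132 n (fun σ => (longestRepeat patternUUUD σ : ℝ)))
      ~[atTop] (fun n : ℕ => (4 / 11 : ℝ) * (n : ℝ)) := by
  constructor
  · intro n σ hσ
    obtain ⟨t, -, ht⟩ := exists_treeWord_eq_permWord hσ
    rw [longestRepeat_UUUD (ht ▸ isMaxUUUD_treeWord t 0)]
    split_ifs with h
    · exact .inl rfl
    · exact .inr ⟨_, by omega, rfl⟩
  · have hc := catalan_cast_pos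
    let E : ℕ → ℝ := fun n => treeSum (fun t => ((treeMax t / 4 : ℕ) : ℝ)) n / catalan n
    -- The bound holds tree by tree, so it survives averaging and vanishes after division by `n`.
    have hE : ∀ n, |avoidExpect perm132 n (fun σ => (longestRepeat patternUUUD σ : ℝ)) - 4 * E n|
        ≤ 4 := by
      intro n
      rw [avoidExpect_longestRepeat, ← mul_div_assoc, ← sub_div, abs_div, abs_of_pos (hc n),
        div_le_iff₀ (hc n), treeSum, Finset.mul_sum, ← Finset.sum_sub_distrib]
      refine (Finset.abs_sum_le_sum_abs _ _).trans ?_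
      rw [← BinaryTree.treesOfNumNodesEq_card_eq_catalan, mul_comm, ← nsmul_eq_mul]
      refine Finset.sum_le_card_nsmul _ _ _ fun t _ => ?_
      generalize treeMax t = M
      obtain ⟨h1, h2⟩ : (if M < 5 then 0 else 4 * ((M - 1) / 4) + 1) ≤ 4 * (M / 4) + 4 ∧
          4 * (M / 4) ≤ (if M < 5 then 0 else 4 * ((M - 1) / 4) + 1) + 4 := by
        split_ifs <;> omega
      have h1' := (Nat.cast_le (α := ℝ)).2 h1
      have h2' := (Nat.cast_le (α := ℝ)).2 h2
      simp only [Nat.cast_add, Nat.cast_mul, Nat.cast_ofNat] at h1' h2'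
      rw [abs_le]
      constructor <;> linarith
    refine (isEquivalent_iff_tendsto_one ?_).2 ?_
    · filter_upwards [eventually_ne_atTop 0] with n hn
      positivity
    have h1 := (tendsto_treeSum_treeMax_div_four.const_mul 11)
    have h2 : Tendsto (fun n : ℕ => (avoidExpect perm132 n
        (fun σ => (longestRepeat patternUUUD σ : ℝ)) - 4 * E n) * (n : ℝ)⁻¹) atTop (nhds 0) :=
      bdd_le_mul_tendsto_zero' 4 (Eventually.of_forall hE) tendsto_inv_atTop_nhds_zero_nat
    have h3 := h1.add (h2.const_mul (11 / 4))
    norm_num only at h3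
    refine h3.congr' ?_
    filter_upwards [eventually_ne_atTop 0] with n hn
    have hn' : (n : ℝ) ≠ 0 := by exact_mod_cast hn
    simp only [Pi.div_apply, E]
    field_simp
    ring
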